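/- Let $F$ be a free group of finite rank with a fixed free basis $\Sigma$, and let $A=\Sigma\cup\Sigma^{-1}$. Let $\partial F$ be its boundary, i.e. the space of freely reduced right-infinite words in $A$ with the Cantor-set topology generated by the cylinders $\mathrm{Cyl}(v)$ (the rays with initial segment $v$), $v\in F$, and let $\partial^2F=\{(x,y)\in\partial F\times\partial F: x\ne y\}$, identified with the set of oriented bi-infinite geodesics of the Cayley graph of $F$ with respect to $A$. Every $\Phi\in\mathrm{Aut}(F)$ extends to a homeomorphism of $\partial F$, again denoted $\Phi$; in particular each $f\in F$ acts on $\partial F$ as the inner automorphism $w\mapsto fwf^{-1}$. For $x,y\in F$ let $\mathrm{Cyl}([x,y])\subset\partial^2F$ be the set of geodesics passing through the oriented segment from $x$ to $y$, and let $B=\mathrm{Cyl}([1,1])$ be the set of geodesics passing through $1$. A geodesic current is an $F$-invariant Borel measure on $\partial^2F$ that is finite on compact sets. Its corresponding frequency measure is the finite shift-invariant Borel measure $\mu$ on $\partial F$ with $\eta(\mathrm{Cyl}([x,y]))=\mu(\mathrm{Cyl}(x^{-1}y))$ for all $x,y\in F$. The $\eta$-length of $\Phi\in\mathrm{Aut}(F)$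 is $L_\eta(\Phi)=\big((\Phi\times\Phi)_*\eta\big)(B)$. **Theorem 5.2.** Let $\eta$ be a nonzero geodesic current and let $\mu$ be its corresponding frequency measure. Suppose that there are a constant $c>0$ and, for each $f\in F$, a constant $b(f)>0$ such that, for all $f\in F$ and all disjoint Borel sets $E,S\subset\partial F$, $$\mu(fE)\ge b(f)\,\mu(E)\qquad\text{and}\qquad \eta(E\times S)\ge c\,\mu(E)\,\mu(S).$$ Then length compactness holds for the $\eta$-length: 1. If $(\Phi_n)$ is a sequence in $\mathrm{Aut}(F)$ and the sequence $L_\eta(\Phi_n)$ is bounded, then there are elements $v_n\in F$ such that the sequence of automorphisms $x\mapsto v_n\Phi_n(x)v_n^{-1}$ has a constant subsequence. 2. For every sequence $(\Phi_n)$ in $\mathrm{Aut}(F)$ there are a subsequence $(\Phi_{n_i})$ and elements $v_i\in F$ such that exactly one of the following holds: the automorphisms $x\mapsto v_i\Phi_{n_i}(x)v_i^{-1}$ are all equal to one automorphism of $F$; or $L_\eta(\Phi_{n_i})\to\infty$ as $i\to\infty$. -/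

import Mathlib

open MeasureTheory Filter Topology
open scoped ENNReal NNReal

/-! Boundary of the free group `FreeGroup α`. The fixed free basis is `α`, the alphabet is
`α × Bool` (generators and their inverses), and `FreeGroup.norm` is the word length. -/

/-- The boundary at infinity: freely reduced right-infinite words in the alphabet `α × Bool`. -/
def Boundary (α : Type*) : Type _ :=
  {x : ℕ → α × Bool // ∀ n, (x n).1 = (x (n + 1)).1 → (x n).2 = (x (n + 1)).2}

namespace Boundary

variable {α : Type*}

/-- The initial segment with `m` letters of a ray. -/
def initial (x : Boundary α) (m : ℕ) : List (α × Bool) :=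
  (List.range m).map x.1

/-- The rays having the freely reduced word `v` as initial segment. -/
def cyl [DecidableEq α] (v : FreeGroup α) : Set (Boundary α) :=
  {x | x.initial v.norm = v.toWord}

/-- The Cantor-set topology, generated by the cylinders. -/
instance [DecidableEq α] : TopologicalSpace (Boundary α) :=
  TopologicalSpace.generateFrom (Set.range (cyl (α := α)))

instance [DecidableEq α] : MeasurableSpace (Boundary α) := borel _

instance [DecidableEq α] : BorelSpace (Boundary α) := ⟨rfl⟩

/-- The shift, deleting the first letter of a ray. -/
def shift (x : Boundary α) : Boundary α :=
  ⟨fun n => x.1 (n + 1), fun n => x.2 (n + 1)⟩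

/-- The sequence `g` of vertices of the Cayley graph converges to the boundary point `x`. -/
def IsLimit [DecidableEq α] (g : ℕ → FreeGroup α) (x : Boundary α) : Prop :=
  ∀ m, ∀ᶠ n in atTop, x.initial m <+: (g n).toWord

end Boundary

/-! Automorphisms of the free group extend continuously and injectively to the boundary. -/

namespace FreeGroup

variable {α : Type*}

theorem toWord_mk_of_isReduced [DecidableEq α] {L : List (α × Bool)} (h : IsReduced L) :
    (mk L).toWord = L := by
  rw [toWord_mk, h.reduce_eq]

theorem take_toWord_mul_letter [DecidableEq α] (u : FreeGroup α) (s : α × Bool) (m : ℕ)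
    (hm : m + 1 ≤ u.norm) :
    (u * mk [s]).toWord.take m = u.toWord.take m ∧ u.norm ≤ (u * mk [s]).norm + 1 := by
  rcases List.eq_nil_or_concat u.toWord with h | ⟨w, l, h⟩
  · simp [norm, h] at hm
  rw [List.concat_eq_append] at h
  have hr : IsReduced (w ++ [l]) := h ▸ isReduced_toWord
  have hu : u = mk (w ++ [l]) := by rw [← h, mk_toWord]
  have hn : u.norm = w.length + 1 := by simp [norm, h]
  have hmul : u * mk [s] = mk (w ++ [l] ++ [s]) := by rw [hu, mul_mk]
  by_cases hc : l.1 = s.1 → l.2 = s.2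
  · have hr' : IsReduced (w ++ [l] ++ [s]) :=
      IsReduced.append_overlap hr (by simpa [IsReduced] using hc) (by simp)
    have : (u * mk [s]).toWord = w ++ [l] ++ [s] := by
      rw [hmul, toWord_mk_of_isReduced hr']
    refine ⟨?_, ?_⟩
    · rw [this, h, List.take_append_of_le_length (by simp; omega)]
    · rw [hn, norm, this]; simp
  · push Not at hc
    obtain ⟨h1, h2⟩ := hc
    have hs : s = (l.1, !l.2) := by
      ext
      · exact h1.symm
      · rcases l with ⟨a, b⟩; rcases s with ⟨c, d⟩
        cases b <;> cases d <;> simp_all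
    have hw : IsReduced w := hr.infix ⟨[], [l], by simp⟩
    have : mk (w ++ [l] ++ [s]) = mk w := by
      have : Red.Step (w ++ (l.1, l.2) :: (l.1, !l.2) :: []) (w ++ []) := Red.Step.not
      rw [hs]
      have h4 : mk (w ++ (l.1, l.2) :: (l.1, !l.2) :: []) = mk (w ++ []) := Quot.sound this
      simpa using h4
    have h3 : (u * mk [s]).toWord = w := by
      rw [hmul, this, toWord_mk_of_isReduced hw]
    refine ⟨?_, ?_⟩
    · rw [h3, h, List.take_append_of_le_length (by omega)]
    · rw [hn, norm, h3]

theorem take_toWord_mul [DecidableEq α] (L : List (α × Bool)) :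
    ∀ (u : FreeGroup α) (m : ℕ), m + L.length ≤ u.norm →
      (u * mk L).toWord.take m = u.toWord.take m := by
  induction L with
  | nil => intro u m _; rw [← one_eq_mk, mul_one]
  | cons s L ih =>
    intro u m h
    simp only [List.length_cons] at h
    obtain ⟨h1, h2⟩ := take_toWord_mul_letter u s m (by omega)
    have : mk (s :: L) = mk [s] * mk L := by rw [mul_mk]; rfl
    rw [this, ← mul_assoc, ih _ m (by omega), h1]

theorem exists_norm_lt_of_norm_map_lt [Finite α] [DecidableEq α] (Φ : MulAut (FreeGroup α))
    (K : ℕ) : ∃ N, ∀ w : FreeGroup α, N ≤ w.norm → K ≤ (Φ w).norm := by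
  have h1 : {w : FreeGroup α | (Φ w).norm < K}.Finite := by
    have := (List.finite_length_lt (α × Bool) K).preimage
      (f := fun w : FreeGroup α => (Φ w).toWord)
      (fun a _ b _ h => Φ.injective (toWord_injective h))
    exact this
  obtain ⟨N, hN⟩ := (h1.image norm).bddAbove
  refine ⟨N + 1, fun w hw => ?_⟩
  by_contra hc
  have := hN ⟨w, not_le.mp hc, rfl⟩
  omega

theorem exists_prefix_control [Finite α] [DecidableEq α] (Φ : MulAut (FreeGroup α)) (m : ℕ) :
    ∃ N, ∀ (p : List (α × Bool)), N ≤ p.length → ∀ w : FreeGroup α, p <+: w.toWord →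
      m ≤ (Φ w).norm ∧ (Φ w).toWord.take m = (Φ (mk p)).toWord.take m := by
  obtain ⟨M, hM⟩ := (Set.finite_range (fun s : α × Bool => (Φ (mk [s])).norm)).bddAbove
  obtain ⟨N, hN⟩ := exists_norm_lt_of_norm_map_lt Φ (m + M)
  refine ⟨N, fun p hp w hw => ?_⟩
  have key : ∀ L : List (α × Bool), IsReduced (p ++ L) →
      m ≤ (Φ (mk (p ++ L))).norm ∧
      (Φ (mk (p ++ L))).toWord.take m = (Φ (mk p)).toWord.take m := by
    intro L
    induction L using List.reverseRecOn with
    | nil =>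
      intro h
      rw [List.append_nil] at h ⊢
      have := hN (mk p) (by rw [norm, toWord_mk_of_isReduced h]; exact hp)
      exact ⟨by omega, rfl⟩
    | append_singleton L s ih =>
      intro h
      have h' : IsReduced (p ++ L) := h.infix ⟨[], [s], by simp⟩
      obtain ⟨_, h2⟩ := ih h'
      have h3 := hN (mk (p ++ L)) (by
        rw [norm, toWord_mk_of_isReduced h', List.length_append]; omega)
      have h4 := hN (mk (p ++ (L ++ [s]))) (by
        rw [norm, toWord_mk_of_isReduced h, List.length_append]; omega)
      refine ⟨by omega, ?_⟩
      have hs : (Φ (mk [s])).toWord.length ≤ M := hM ⟨s, rfl⟩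
      have : Φ (mk (p ++ (L ++ [s]))) = Φ (mk (p ++ L)) * mk (Φ (mk [s])).toWord := by
        rw [mk_toWord, ← _root_.map_mul, mul_mk, List.append_assoc]
      rw [this, take_toWord_mul _ _ m (by omega), h2]
  obtain ⟨L, hL⟩ := hw
  have := key L (hL ▸ isReduced_toWord)
  rwa [hL, mk_toWord] at this

end FreeGroup

namespace Boundary

variable {α : Type*}

theorem length_initial (x : Boundary α) (m : ℕ) : (x.initial m).length = m := by
  simp [initial]

theorem isReduced_initial (x : Boundary α) (m : ℕ) : FreeGroup.IsReduced (x.initial m) := by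
  rw [FreeGroup.IsReduced, List.isChain_iff_getElem]
  intro i hi
  simpa [initial] using x.2 i

theorem initial_prefix (x : Boundary α) {m n : ℕ} (h : m ≤ n) :
    x.initial m <+: x.initial n := by
  rw [initial, initial]
  refine List.IsPrefix.map _ ?_
  rw [List.prefix_iff_eq_take]
  simp [List.take_range, h]

theorem ext_initial {x y : Boundary α} (h : ∀ m, x.initial m = y.initial m) : x = y := by
  apply Subtype.ext
  funext n
  have := congrArg (fun l => l[n]?) (h (n + 1))
  simpa [initial] using this

theorem isLimit_initial [DecidableEq α] (x : Boundary α) :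
    IsLimit (fun n => FreeGroup.mk (x.initial n)) x := by
  intro m
  filter_upwards [eventually_ge_atTop m] with n hn
  rw [FreeGroup.toWord_mk_of_isReduced (x.isReduced_initial n)]
  exact x.initial_prefix hn

theorem IsLimit.unique [DecidableEq α] {g : ℕ → FreeGroup α} {x y : Boundary α}
    (hx : IsLimit g x) (hy : IsLimit g y) : x = y := by
  refine ext_initial fun m => ?_
  obtain ⟨n, h1, h2⟩ := ((hx m).and (hy m)).exists
  rw [List.prefix_iff_eq_take, length_initial] at h1 h2
  rw [h1, h2]

/-- Every automorphism `Φ` extends to the boundary: for each ray `x` there is `y` such that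
`Φ (g n)` converges to `y` whenever `g n` converges to `x`. -/
theorem exists_extension [Finite α] [DecidableEq α] (Φ : MulAut (FreeGroup α))
    (x : Boundary α) :
    ∃ y : Boundary α, ∀ g, IsLimit g x → IsLimit (fun n => Φ (g n)) y := by
  choose N hN using FreeGroup.exists_prefix_control Φ
  have hred : ∀ n, x.initial n <+: (FreeGroup.mk (x.initial n)).toWord := fun n => by
    rw [FreeGroup.toWord_mk_of_isReduced (x.isReduced_initial n)]
  set W : ℕ → List (α × Bool) :=
    fun m => (Φ (FreeGroup.mk (x.initial (N m)))).toWord.take m with hW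
  have hWlen : ∀ m, (W m).length = m := by
    intro m
    have := (hN m (x.initial (N m)) (by rw [length_initial]) _ (hred _)).1
    rw [hW, List.length_take]
    exact min_eq_left this
  have hW' : ∀ m n, m ≤ n → W m = (W n).take m := by
    intro m n h
    have h1 := (hN m (x.initial (N m)) (by rw [length_initial])
      (FreeGroup.mk (x.initial (max (N m) (N n))))
      ((x.initial_prefix (le_max_left _ _)).trans (hred _))).2
    have h2 := (hN n (x.initial (N n)) (by rw [length_initial])
      (FreeGroup.mk (x.initial (max (N m) (N n))))
      ((x.initial_prefix (le_max_right _ _)).trans (hred _))).2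
    simp only [hW]
    rw [← h1, ← h2, List.take_take, min_eq_left h]
  have hget : ∀ m n (h : m < n),
      (W n)[m]'(by rw [hWlen]; exact h) = (W (m + 1))[m]'(by rw [hWlen]; omega) := by
    intro m n h
    simp only [hW' (m + 1) n h, List.getElem_take]
  have hWred : ∀ m, FreeGroup.IsReduced (W m) := fun m =>
    (FreeGroup.isReduced_toWord (x := Φ (FreeGroup.mk (x.initial (N m))))).infix
      (List.take_prefix _ _).isInfix
  let y : Boundary α := ⟨fun m => (W (m + 1))[m]'(by rw [hWlen]; omega), fun m => by
    have h := hWred (m + 2)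
    rw [FreeGroup.IsReduced, List.isChain_iff_getElem] at h
    have h' := h m (by rw [hWlen]; omega)
    rw [hget m (m + 2) (by omega)] at h'
    exact h'⟩
  have hy : ∀ m, y.initial m = W m := by
    intro m
    refine List.ext_getElem (by rw [length_initial, hWlen]) fun i h1 h2 => ?_
    rw [length_initial] at h1
    rw [hget i m h1]
    simp [initial, y]
  refine ⟨y, fun g hg m => ?_⟩
  filter_upwards [hg (N m)] with n hn
  rw [hy, hW]
  simp only
  rw [← (hN m (x.initial (N m)) (by rw [length_initial]) _ hn).2]
  exact List.take_prefix _ _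

/-- The continuous extension of an automorphism `Φ` to the boundary. -/
noncomputable def map [Finite α] [DecidableEq α] (Φ : MulAut (FreeGroup α))
    (x : Boundary α) : Boundary α :=
  (exists_extension Φ x).choose

theorem map_spec [Finite α] [DecidableEq α] (Φ : MulAut (FreeGroup α)) {x : Boundary α}
    {g : ℕ → FreeGroup α} (hg : IsLimit g x) : IsLimit (fun n => Φ (g n)) (map Φ x) :=
  (exists_extension Φ x).choose_spec g hg

theorem map_injective [Finite α] [DecidableEq α] (Φ : MulAut (FreeGroup α)) :
    Function.Injective (map Φ) := by
  have h : ∀ x, map Φ⁻¹ (map Φ x) = x := fun x => by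
    have h1 := map_spec Φ⁻¹ (map_spec Φ (isLimit_initial x))
    refine IsLimit.unique h1 ?_
    simpa using isLimit_initial x
  exact Function.LeftInverse.injective h

end Boundary

/-! Pairs of distinct boundary points, that is, oriented bi-infinite geodesics. -/

/-- The space `∂²F` of ordered pairs of distinct boundary points. -/
def Boundary2 (α : Type*) : Type _ :=
  {z : Boundary α × Boundary α // z.1 ≠ z.2}

namespace Boundary2

variable {α : Type*} [DecidableEq α]

instance : TopologicalSpace (Boundary2 α) :=
  inferInstanceAs (TopologicalSpace {z : Boundary α × Boundary α // z.1 ≠ z.2})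

instance : MeasurableSpace (Boundary2 α) := borel _

instance : BorelSpace (Boundary2 α) := ⟨rfl⟩

/-- The action `Φ × Φ` of an automorphism on `∂²F`. -/
noncomputable def map [Finite α] (Φ : MulAut (FreeGroup α)) (z : Boundary2 α) : Boundary2 α :=
  ⟨(Boundary.map Φ z.1.1, Boundary.map Φ z.1.2),
    fun h => z.2 (Boundary.map_injective Φ h)⟩

/-- `γ` is a bi-infinite geodesic of the Cayley graph, oriented from `z.1.1` to `z.1.2`. -/
structure IsGeodesic (γ : ℤ → FreeGroup α) (z : Boundary2 α) : Prop where
  dist_eq : ∀ i j, ((γ i)⁻¹ * γ j).norm = (i - j).natAbs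
  limit_neg : Boundary.IsLimit (fun n : ℕ => γ (-(n : ℤ))) z.1.1
  limit_pos : Boundary.IsLimit (fun n : ℕ => γ (n : ℤ)) z.1.2

/-- The geodesics passing through the oriented segment from `x` to `y`. -/
def cyl (x y : FreeGroup α) : Set (Boundary2 α) :=
  {z | ∃ γ, IsGeodesic γ z ∧ ∃ i j : ℤ, i ≤ j ∧ γ i = x ∧ γ j = y}

/-- The base-ball: the geodesics passing through the base point `1`. -/
def baseBall (α : Type*) [DecidableEq α] : Set (Boundary2 α) :=
  {z | ∃ γ, IsGeodesic γ z ∧ ∃ i : ℤ, γ i = 1}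

/-- The product `E × S`, as a set of pairs of distinct points. -/
def prod (E S : Set (Boundary α)) : Set (Boundary2 α) :=
  {z | z.1.1 ∈ E ∧ z.1.2 ∈ S}

end Boundary2

section Currents

variable {α : Type*} [Finite α] [DecidableEq α]

/-- Geodesic currents: Borel measures on `∂²F` that are finite on compact sets and invariant
under `F`, which acts through inner automorphisms. -/
structure IsGeodesicCurrent (η : Measure (Boundary2 α)) : Prop where
  finite_of_isCompact : ∀ K, IsCompact K → η K < ∞
  invariant : ∀ f : FreeGroup α, η.map (Boundary2.map (MulAut.conj f)) = η

/-- Frequency measures: finite shift-invariant Borel measures on `∂F`. -/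
structure IsFrequencyMeasure (μ : Measure (Boundary α)) : Prop where
  finite : μ Set.univ < ∞
  invariant : μ.map Boundary.shift = μ

/-- The frequency measure `μ` corresponds to the geodesic current `η`. -/
def Corresponds (η : Measure (Boundary2 α)) (μ : Measure (Boundary α)) : Prop :=
  ∀ x y : FreeGroup α, η (Boundary2.cyl x y) = μ (Boundary.cyl (x⁻¹ * y))

/-- The length of a current: the measure of the base-ball. -/
noncomputable def currentLength (η : Measure (Boundary2 α)) : ℝ≥0∞ :=
  η (Boundary2.baseBall α)

/-- The `η`-length of an automorphism: the length of the push-forward `Φη`. -/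
noncomputable def etaLength (η : Measure (Boundary2 α)) (Φ : MulAut (FreeGroup α)) : ℝ≥0∞ :=
  currentLength (η.map (Boundary2.map Φ))

end Currents

/-! Reduced words. -/

namespace FreeGroup

variable {α : Type*}

/-! Everything follows from a bound that depends only on `M`: if `L_η(Φ) ≤ M`, some conjugate of `Φ`
sends every basis element to a word of length at most `R`. Only finitely many automorphisms do so,
and a pigeonhole finishes part 1.

To find the conjugate, push `μ` forward to `ν = Φ_*μ`. It is quasi-invariant under left translation
by `Φ(f)`, with one constant `β` for all `|f| ≤ 2`, independent of `Φ`. Removing a vertex `g` cuts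
the boundary into half-trees `dirSet g a`; call a direction heavy if its `ν`-mass exceeds a
threshold independent of `Φ`. If each vertex had only one heavy direction, its label would be
constant along the tree, which is absurd in rank at least 2. If no vertex had three, the vertices
`Φ(f)x`, `|f| ≤ 2`, would be strung along a line through a vertex `x` with two heavy directions, and
two basis elements would commute. So some vertex has three heavy directions (`exists_three_heavy`);
conjugation moves it to `1`.

Let `v` be the new image of a basis element. Quasi-invariance makes `Cyl(v)` heavy, and two of the
three heavy directions differ from the first letter of `v`. Geodesics coming from such a direction
and running through `v` have `η`-mass bounded below by the product hypothesis. Translating by the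
inverses of initial segments of `v` puts about `|v|/2` copies inside the base-ball, and for one of
the two directions these copies are disjoint (`pairwiseDisjoint_branchSet_or`). Hence the length
grows at least linearly in `|v|`.

Part 2 also needs that `L_η` is finite and unchanged by inner automorphisms, so the two alternatives
exclude each other. -/

theorem IsReduced.invRev [DecidableEq α] {U : List (α × Bool)} (hU : IsReduced U) :
    IsReduced (invRev U) := by
  rw [← toWord_mk_of_isReduced hU, ← toWord_inv]
  exact isReduced_toWord

theorem isReduced_invRev_append [DecidableEq α] {U W : List (α × Bool)} (hU : IsReduced U)
    (hW : IsReduced W) (h : ∀ a ∈ U.head?, a ∉ W.head?) : IsReduced (FreeGroup.invRev U ++ W) := by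
  rw [IsReduced, List.isChain_append]
  refine ⟨hU.invRev, hW, ?_⟩
  cases U with
  | nil => simp
  | cons a U =>
    intro x hx y hy
    have hx' : x = (a.1, !a.2) := by
      simpa [FreeGroup.invRev, eq_comm] using hx
    subst hx'
    intro h1
    by_contra h2
    refine h a (by simp) ?_
    have : a = y := by
      ext
      · exact h1
      · rcases a with ⟨a, b⟩; rcases y with ⟨c, d⟩
        cases b <;> cases d <;> simp_all
    rwa [this]

theorem toWord_inv_mul [DecidableEq α] {u w : FreeGroup α}
    (h : ∀ a ∈ u.toWord.head?, a ∉ w.toWord.head?) :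
    (u⁻¹ * w).toWord = invRev u.toWord ++ w.toWord := by
  conv_lhs => rw [← mk_toWord (x := u), ← mk_toWord (x := w), inv_mk, mul_mk]
  exact toWord_mk_of_isReduced (isReduced_invRev_append isReduced_toWord isReduced_toWord h)

theorem norm_inv_mul_of_head_ne [DecidableEq α] {u w : FreeGroup α}
    (h : ∀ a ∈ u.toWord.head?, a ∉ w.toWord.head?) :
    (u⁻¹ * w).norm = u.norm + w.norm := by
  rw [norm, toWord_inv_mul h, List.length_append, invRev_length, norm, norm]

/-- A common first letter would cancel and make the product shorter. -/
theorem head_ne_of_norm_inv_mul [DecidableEq α] {u w : FreeGroup α}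
    (h : (u⁻¹ * w).norm = u.norm + w.norm) : ∀ a ∈ u.toWord.head?, a ∉ w.toWord.head? := by
  intro a hu hw
  obtain ⟨U, hU⟩ : ∃ U, u.toWord = a :: U := by
    cases hh : u.toWord <;> simp_all
  obtain ⟨W, hW⟩ : ∃ W, w.toWord = a :: W := by
    cases hh : w.toWord <;> simp_all
  have hu' : u = mk [a] * mk U := by rw [mul_mk, ← mk_toWord (x := u), hU]; rfl
  have hw' : w = mk [a] * mk W := by rw [mul_mk, ← mk_toWord (x := w), hW]; rfl
  have h1 : u⁻¹ * w = (mk U)⁻¹ * mk W := by rw [hu', hw']; group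
  have h2 := norm_mul_le (mk U)⁻¹ (mk W)
  rw [← h1, h, norm_inv_eq] at h2
  have h3 := norm_mk_le (L₁ := U)
  have h4 := norm_mk_le (L₁ := W)
  simp only [norm, hU, hW, List.length_cons] at h2 h3 h4
  omega

theorem norm_inv_mul_comm [DecidableEq α] (u w : FreeGroup α) :
    (u⁻¹ * w).norm = (w⁻¹ * u).norm := by
  rw [← norm_inv_eq (x := u⁻¹ * w)]; simp

theorem head?_toWord_inv_ne [DecidableEq α] {g : FreeGroup α} {a : α × Bool}
    (h : g⁻¹.toWord.head? ≠ some a) : IsReduced (g.toWord ++ [a]) := by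
  have := isReduced_invRev_append (isReduced_toWord (x := g⁻¹)) (IsReduced.singleton (a := a))
    (by rintro b hb hb'; simp_all)
  rwa [← toWord_inv, inv_inv] at this

theorem finite_norm_le [Finite α] [DecidableEq α] (N : ℕ) : {u : FreeGroup α | u.norm ≤ N}.Finite :=
  (List.finite_length_le (α × Bool) N).preimage (f := toWord) toWord_injective.injOn

theorem exists_head?_toWord [DecidableEq α] {g : FreeGroup α} (h : g ≠ 1) :
    ∃ a, g.toWord.head? = some a := by
  cases hh : g.toWord with
  | nil => exact absurd (toWord_eq_nil_iff.mp hh) h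
  | cons a L => exact ⟨a, rfl⟩

end FreeGroup

/-! The action on the boundary. -/

namespace Boundary

variable {α : Type*}

theorem initial_one (x : Boundary α) : x.initial 1 = [x.1 0] := by
  simp [initial]

theorem initial_getElem (x : Boundary α) {m i : ℕ} (h : i < (x.initial m).length) :
    (x.initial m)[i] = x.1 i := by
  simp [initial]

theorem head?_initial (x : Boundary α) {m : ℕ} (h : m ≠ 0) : (x.initial m).head? = some (x.1 0) := by
  obtain ⟨m, rfl⟩ := Nat.exists_eq_succ_of_ne_zero h
  simp [initial, List.range_succ_eq_map]

theorem take_initial (x : Boundary α) {m n : ℕ} (h : m ≤ n) :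
    (x.initial n).take m = x.initial m := by
  have := x.initial_prefix h
  rw [List.prefix_iff_eq_take, length_initial] at this
  exact this.symm

variable [DecidableEq α]

theorem norm_mk_initial (x : Boundary α) (n : ℕ) : (FreeGroup.mk (x.initial n)).norm = n := by
  rw [FreeGroup.norm, FreeGroup.toWord_mk_of_isReduced (x.isReduced_initial n), length_initial]

theorem mem_cyl_mk_initial (x y : Boundary α) (n : ℕ) :
    y ∈ cyl (FreeGroup.mk (x.initial n)) ↔ y.initial n = x.initial n := by
  rw [cyl, Set.mem_ofPred_eq, norm_mk_initial,
    FreeGroup.toWord_mk_of_isReduced (x.isReduced_initial n)]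

theorem cyl_mk_singleton (a : α × Bool) : cyl (FreeGroup.mk [a]) = {x : Boundary α | x.1 0 = a} := by
  ext x
  have h : (FreeGroup.mk [a]).toWord = [a] :=
    FreeGroup.toWord_mk_of_isReduced FreeGroup.IsReduced.singleton
  simp [cyl, FreeGroup.norm, h, initial_one]

theorem isOpen_cyl (v : FreeGroup α) : IsOpen (cyl v) :=
  TopologicalSpace.isOpen_generateFrom_of_mem ⟨v, rfl⟩

theorem isOpen_letter_eq (a : α × Bool) : IsOpen {x : Boundary α | x.1 0 = a} :=
  cyl_mk_singleton a ▸ isOpen_cyl _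

/-- Right multiplication by `w` changes at most the last `w.norm` letters. Hence conjugation by `w`
acts on the boundary as left multiplication by `w`. -/
theorem IsLimit.mul_right {g : ℕ → FreeGroup α} {x : Boundary α} (h : IsLimit g x)
    (w : FreeGroup α) : IsLimit (fun n => g n * w) x := by
  intro m
  filter_upwards [h (m + w.norm)] with n hn
  have h1 := hn.length_le
  rw [length_initial] at h1
  have h2 := FreeGroup.take_toWord_mul w.toWord (g n) m h1
  rw [FreeGroup.mk_toWord] at h2
  have h3 := (x.initial_prefix (Nat.le_add_right m w.norm)).trans hn
  rw [List.prefix_iff_eq_take, length_initial] at h3 ⊢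
  rw [h2, ← h3]

variable [Finite α]

theorem map_mul (Φ Ψ : MulAut (FreeGroup α)) (x : Boundary α) :
    map (Φ * Ψ) x = map Φ (map Ψ x) :=
  IsLimit.unique (map_spec (Φ * Ψ) (isLimit_initial x))
    (map_spec Φ (map_spec Ψ (isLimit_initial x)))

theorem map_one (x : Boundary α) : map 1 x = x :=
  IsLimit.unique (map_spec 1 (isLimit_initial x)) (isLimit_initial x)

theorem map_inv_map (Φ : MulAut (FreeGroup α)) (x : Boundary α) : map Φ⁻¹ (map Φ x) = x := by
  rw [← map_mul, inv_mul_cancel, map_one]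

theorem map_map_inv (Φ : MulAut (FreeGroup α)) (x : Boundary α) : map Φ (map Φ⁻¹ x) = x := by
  rw [← map_mul, mul_inv_cancel, map_one]

theorem IsLimit.mul_left {g : ℕ → FreeGroup α} {x : Boundary α} (h : IsLimit g x)
    (w : FreeGroup α) : IsLimit (fun n => w * g n) (map (MulAut.conj w) x) := by
  have := (map_spec (MulAut.conj w) h).mul_right w
  simpa [MulAut.conj_apply] using this

/-- Initial segments of `Φ x` are determined by long initial segments of `x`. -/
theorem exists_initial_map (Φ : MulAut (FreeGroup α)) (m : ℕ) :
    ∃ N, ∀ x, (map Φ x).initial m = (Φ (FreeGroup.mk (x.initial N))).toWord.take m := by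
  obtain ⟨N, hN⟩ := FreeGroup.exists_prefix_control Φ m
  refine ⟨N, fun x => ?_⟩
  obtain ⟨n, h1, h2⟩ :=
    ((map_spec Φ (isLimit_initial x) m).and (isLimit_initial x N)).exists
  rw [List.prefix_iff_eq_take, length_initial] at h1
  rw [h1]
  exact (hN _ (length_initial x N).ge _ h2).2

theorem continuous_map (Φ : MulAut (FreeGroup α)) : Continuous (map Φ) := by
  refine continuous_generateFrom_iff.mpr ?_
  rintro _ ⟨v, rfl⟩
  refine isOpen_iff_forall_mem_open.mpr fun x hx => ?_
  obtain ⟨N, hN⟩ := exists_initial_map Φ v.norm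
  refine ⟨cyl (FreeGroup.mk (x.initial N)), fun y hy => ?_, isOpen_cyl _,
    (mem_cyl_mk_initial x x N).mpr rfl⟩
  rw [mem_cyl_mk_initial] at hy
  simp only [Set.mem_preimage, cyl, Set.mem_ofPred_eq] at hx ⊢
  rw [hN, hy, ← hN, hx]

/-- Without cancellation, the action of `w` is concatenation. -/
theorem initial_map_conj {w : FreeGroup α} {y : Boundary α}
    (h : FreeGroup.IsReduced (w.toWord ++ [y.1 0])) (m : ℕ) :
    (map (MulAut.conj w) y).initial (w.norm + m) = w.toWord ++ y.initial m := by
  have hr : ∀ n, FreeGroup.IsReduced (w.toWord ++ y.initial n) := by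
    intro n
    rcases eq_or_ne n 0 with rfl | hn
    · simpa [initial] using FreeGroup.isReduced_toWord
    · have h1 := y.head?_initial hn
      obtain ⟨L, hL⟩ : ∃ L, y.initial n = y.1 0 :: L := by
        cases hh : y.initial n <;> simp_all
      have := FreeGroup.IsReduced.append_overlap (L₁ := w.toWord) (L₂ := [y.1 0]) (L₃ := L) h
        (by simpa [hL] using y.isReduced_initial n) (by simp)
      simpa [hL] using this
  obtain ⟨n, h1, h2⟩ := (((isLimit_initial y).mul_left w (w.norm + m)).and
    (eventually_ge_atTop m)).exists
  have h3 : (w * FreeGroup.mk (y.initial n)).toWord = w.toWord ++ y.initial n := by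
    conv_lhs => rw [← FreeGroup.mk_toWord (x := w), FreeGroup.mul_mk]
    exact FreeGroup.toWord_mk_of_isReduced (hr n)
  rw [List.prefix_iff_eq_take, length_initial, h3, FreeGroup.norm,
    List.take_length_add_append, take_initial _ h2] at h1
  exact h1

theorem map_conj_apply_norm_add {w : FreeGroup α} {y : Boundary α}
    (h : FreeGroup.IsReduced (w.toWord ++ [y.1 0])) (i : ℕ) :
    (map (MulAut.conj w) y).1 (w.norm + i) = y.1 i := by
  have h1 := initial_map_conj h (i + 1)
  have h2 := congrArg (fun l => l[w.norm + i]?) h1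
  simpa [initial, FreeGroup.norm] using h2

theorem map_conj_initial_norm {w : FreeGroup α} {y : Boundary α}
    (h : FreeGroup.IsReduced (w.toWord ++ [y.1 0])) :
    (map (MulAut.conj w) y).initial w.norm = w.toWord := by
  simpa [initial] using initial_map_conj h 0

theorem map_conj_mem_cyl {w : FreeGroup α} {y : Boundary α}
    (h : w⁻¹.toWord.head? ≠ some (y.1 0)) : map (MulAut.conj w) y ∈ cyl w :=
  map_conj_initial_norm (FreeGroup.head?_toWord_inv_ne h)

theorem map_conj_inv_apply {w : FreeGroup α} {y : Boundary α} (h : y ∈ cyl w) (i : ℕ) :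
    (map (MulAut.conj w⁻¹) y).1 i = y.1 (w.norm + i) := by
  -- The ray left after deleting the prefix `w`; multiplying it by `w` involves no cancellation and
  -- restores `y`.
  let y' : Boundary α := ⟨fun n => y.1 (w.norm + n), fun n => y.2 (w.norm + n)⟩
  have hy' : FreeGroup.IsReduced (w.toWord ++ [y'.1 0]) := by
    have h1 := y.isReduced_initial (w.norm + 1)
    have h2 : y.initial (w.norm + 1) = y.initial w.norm ++ [y.1 w.norm] := by
      simp [initial, List.range_succ]
    rw [h2, h] at h1
    exact h1
  have : map (MulAut.conj w) y' = y := by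
    refine ext_initial fun m => ?_
    refine List.ext_getElem (by simp [length_initial]) fun i h1 h2 => ?_
    rw [initial_getElem, initial_getElem]
    rcases lt_or_ge i w.norm with hi | hi
    · have h3 := (map_conj_initial_norm hy').trans h.symm
      have h4 := congrArg (fun l => l[i]?) h3
      simpa [initial, hi] using h4
    · obtain ⟨j, rfl⟩ := Nat.exists_eq_add_of_le hi
      rw [map_conj_apply_norm_add hy']
  rw [← this, _root_.map_inv, map_inv_map, map_conj_apply_norm_add hy']

/-- The rays whose first edge, seen from the vertex `g`, has label `a`. -/
def dirSet (g : FreeGroup α) (a : α × Bool) : Set (Boundary α) :=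
  {x | (map (MulAut.conj g⁻¹) x).1 0 = a}

theorem isOpen_dirSet (g : FreeGroup α) (a : α × Bool) : IsOpen (dirSet g a) :=
  (isOpen_letter_eq a).preimage (continuous_map (MulAut.conj g⁻¹))

theorem dirSet_mul (v g : FreeGroup α) (a : α × Bool) :
    dirSet (v * g) a = map (MulAut.conj v⁻¹) ⁻¹' dirSet g a := by
  ext x
  simp only [dirSet, Set.mem_preimage, Set.mem_ofPred_eq]
  rw [← map_mul, ← _root_.map_mul, mul_inv_rev]

/-- Half-trees are nested: a direction at `g'` not pointing to `g` lies within the direction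
from `g` to `g'`. -/
theorem dirSet_subset_dirSet {g g' : FreeGroup α} {a s : α × Bool}
    (hs : (g⁻¹ * g').toWord.head? = some s) (ha : (g'⁻¹ * g).toWord.head? ≠ some a) :
    dirSet g' a ⊆ dirSet g s := by
  intro x hx
  have h1 : (g⁻¹ * g')⁻¹.toWord.head? ≠ some ((map (MulAut.conj g'⁻¹) x).1 0) := by
    rw [show (map (MulAut.conj g'⁻¹) x).1 0 = a from hx]
    simpa using ha
  have h2 := map_conj_mem_cyl h1
  rw [← map_mul, ← _root_.map_mul, mul_inv_cancel_right] at h2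
  have h3 := congrArg List.head? (show _ = _ from h2)
  rw [hs, head?_initial] at h3
  · exact Option.some_injective _ h3
  · intro h0
    rw [FreeGroup.norm_eq_zero.mp h0] at hs
    simp at hs

end Boundary

/-! Geodesics through a vertex. -/

namespace Boundary

variable {α : Type*} [DecidableEq α]

theorem norm_inv_mul_initial (x : Boundary α) (m n : ℕ) :
    ((FreeGroup.mk (x.initial m))⁻¹ * FreeGroup.mk (x.initial n)).norm =
      ((m : ℤ) - n).natAbs := by
  wlog h : m ≤ n generalizing m n
  · rw [FreeGroup.norm_inv_mul_comm, this n m (by omega)]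
    omega
  obtain ⟨L, hL⟩ := x.initial_prefix h
  have h1 : FreeGroup.IsReduced L := (x.isReduced_initial n).infix ⟨x.initial m, [], by simp [hL]⟩
  have h2 : L.length = n - m := by
    have := congrArg List.length hL
    simp only [List.length_append, length_initial] at this
    omega
  rw [← hL, ← FreeGroup.mul_mk, inv_mul_cancel_left, FreeGroup.norm,
    FreeGroup.toWord_mk_of_isReduced h1, h2]
  omega

theorem norm_inv_mul_initial_of_ne {x y : Boundary α} (h : x.1 0 ≠ y.1 0) (m n : ℕ) :
    ((FreeGroup.mk (x.initial m))⁻¹ * FreeGroup.mk (y.initial n)).norm = m + n := by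
  rw [FreeGroup.norm_inv_mul_of_head_ne, norm_mk_initial, norm_mk_initial]
  rw [FreeGroup.toWord_mk_of_isReduced (x.isReduced_initial m),
    FreeGroup.toWord_mk_of_isReduced (y.isReduced_initial n)]
  rcases eq_or_ne m 0 with rfl | hm
  · simp [initial]
  rcases eq_or_ne n 0 with rfl | hn
  · simp [initial]
  rw [head?_initial _ hm, head?_initial _ hn]
  simpa using fun h' => h h'.symm

end Boundary

namespace Boundary2

open Boundary

variable {α : Type*} [DecidableEq α]

/-- Rays from `1` with different first letters join without backtracking. -/
theorem exists_isGeodesic {z : Boundary2 α} (h : z.1.1.1 0 ≠ z.1.2.1 0) :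
    ∃ γ, IsGeodesic γ z ∧ γ 0 = 1 := by
  refine ⟨fun n => if 0 ≤ n then FreeGroup.mk (z.1.2.initial n.toNat)
    else FreeGroup.mk (z.1.1.initial (-n).toNat), ⟨fun i j => ?_, ?_, ?_⟩, ?_⟩
  · by_cases hi : 0 ≤ i <;> by_cases hj : 0 ≤ j
    · simp only [hi, hj, if_true]
      rw [norm_inv_mul_initial]
      omega
    · simp only [hi, hj, if_true, if_false]
      rw [norm_inv_mul_initial_of_ne h.symm]
      omega
    · simp only [hi, hj, if_true, if_false]
      rw [norm_inv_mul_initial_of_ne h]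
      omega
    · simp only [hi, hj, if_false]
      rw [norm_inv_mul_initial]
      omega
  · intro m
    filter_upwards [isLimit_initial z.1.1 m, eventually_gt_atTop 0] with n hn hn0
    have : n ≠ 0 := by omega
    simpa [this] using hn
  · intro m
    filter_upwards [isLimit_initial z.1.2 m] with n hn
    simpa using hn
  · simp [initial, FreeGroup.one_eq_mk]

theorem head_ne_of_isGeodesic {γ : ℤ → FreeGroup α} {z : Boundary2 α} (h : IsGeodesic γ z)
    {i : ℤ} (hi : γ i = 1) : z.1.1.1 0 ≠ z.1.2.1 0 := by
  obtain ⟨n, ⟨h1, h2⟩, h3⟩ := (((h.limit_neg 1).and (h.limit_pos 1)).and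
    (eventually_ge_atTop i.natAbs)).exists
  rw [initial_one] at h1 h2
  have e1 := h.dist_eq i (-n)
  have e2 := h.dist_eq i n
  have e3 := h.dist_eq (-n) n
  rw [hi, inv_one, one_mul] at e1 e2
  have := FreeGroup.head_ne_of_norm_inv_mul (u := γ (-n)) (w := γ n) (by omega)
  intro h0
  refine this (z.1.1.1 0) ?_ ?_
  · obtain ⟨L, hL⟩ := h1
    simp [← hL]
  · obtain ⟨L, hL⟩ := h2
    simp [← hL, h0]

theorem baseBall_eq : baseBall α = {z | z.1.1.1 0 ≠ z.1.2.1 0} := by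
  ext z
  constructor
  · rintro ⟨γ, h, i, hi⟩
    exact head_ne_of_isGeodesic h hi
  · intro h
    obtain ⟨γ, h1, h2⟩ := exists_isGeodesic h
    exact ⟨γ, h1, 0, h2⟩

theorem continuous_fst : Continuous fun z : Boundary2 α => z.1.1 :=
  _root_.continuous_fst.comp continuous_subtype_val

theorem continuous_snd : Continuous fun z : Boundary2 α => z.1.2 :=
  _root_.continuous_snd.comp continuous_subtype_val

theorem isOpen_baseBall : IsOpen (baseBall α) := by
  have : baseBall α = ⋃ p ∈ {p : (α × Bool) × (α × Bool) | p.1 ≠ p.2},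
      (fun z : Boundary2 α => z.1.1) ⁻¹' {x | x.1 0 = p.1} ∩
        (fun z : Boundary2 α => z.1.2) ⁻¹' {x | x.1 0 = p.2} := by
    rw [baseBall_eq]
    ext z
    simp
  rw [this]
  exact isOpen_biUnion fun p _ => ((isOpen_letter_eq _).preimage continuous_fst).inter
    ((isOpen_letter_eq _).preimage continuous_snd)

theorem measurableSet_prod {E S : Set (Boundary α)} (hE : MeasurableSet E)
    (hS : MeasurableSet S) : MeasurableSet (prod E S) :=
  (continuous_fst.measurable hE).inter (continuous_snd.measurable hS)

theorem exists_initial_eq_apply_ne (z : Boundary2 α) :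
    ∃ n, z.1.1.initial n = z.1.2.initial n ∧ z.1.1.1 n ≠ z.1.2.1 n := by
  classical
  have h : ∃ n, z.1.1.1 n ≠ z.1.2.1 n := by
    by_contra! hc
    exact z.2 (Subtype.ext (funext hc))
  refine ⟨Nat.find h, ?_, Nat.find_spec h⟩
  simp only [initial]
  refine List.map_congr_left fun i hi => ?_
  simpa using Nat.find_min h (List.mem_range.mp hi)

variable [Finite α]

theorem map_mul (Φ Ψ : MulAut (FreeGroup α)) (z : Boundary2 α) :
    map (Φ * Ψ) z = map Φ (map Ψ z) :=
  Subtype.ext (Prod.ext (Boundary.map_mul Φ Ψ z.1.1) (Boundary.map_mul Φ Ψ z.1.2))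

theorem continuous_map (Φ : MulAut (FreeGroup α)) : Continuous (map Φ) :=
  (((Boundary.continuous_map Φ).comp continuous_fst).prodMk
    ((Boundary.continuous_map Φ).comp continuous_snd)).subtype_mk _

theorem measurable_map (Φ : MulAut (FreeGroup α)) : Measurable (map Φ) :=
  (continuous_map Φ).measurable

theorem IsGeodesic.mul_left {γ : ℤ → FreeGroup α} {z : Boundary2 α} (h : IsGeodesic γ z)
    (w : FreeGroup α) : IsGeodesic (fun i => w * γ i) (map (MulAut.conj w) z) where
  dist_eq i j := by
    rw [← h.dist_eq i j]
    congr 1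
    group
  limit_neg := h.limit_neg.mul_left w
  limit_pos := h.limit_pos.mul_left w

theorem mem_cyl_self {u : FreeGroup α} {z : Boundary2 α}
    (h : map (MulAut.conj u⁻¹) z ∈ baseBall α) : z ∈ cyl u u := by
  obtain ⟨γ, hγ, i, hi⟩ := h
  have h1 := hγ.mul_left u
  rw [← map_mul, ← _root_.map_mul, mul_inv_cancel, _root_.map_one] at h1
  have h2 : map 1 z = z := Subtype.ext (Prod.ext (Boundary.map_one z.1.1) (Boundary.map_one z.1.2))
  rw [h2] at h1
  exact ⟨_, h1, i, i, le_rfl, by simp [hi], by simp [hi]⟩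

/-- A geodesic passes through the vertex where the rays to its ends split. -/
theorem mem_cyl_of_initial {z : Boundary2 α} {n : ℕ} (h : z.1.1.initial n = z.1.2.initial n)
    (h' : z.1.1.1 n ≠ z.1.2.1 n) :
    z ∈ cyl (FreeGroup.mk (z.1.1.initial n)) (FreeGroup.mk (z.1.1.initial n)) := by
  apply mem_cyl_self
  rw [baseBall_eq]
  have h1 := map_conj_inv_apply ((mem_cyl_mk_initial z.1.1 z.1.1 n).mpr rfl) 0
  have h2 := map_conj_inv_apply ((mem_cyl_mk_initial z.1.1 z.1.2 n).mpr h.symm) 0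
  rw [norm_mk_initial] at h1 h2
  change (Boundary.map _ z.1.1).1 0 ≠ (Boundary.map _ z.1.2).1 0
  rw [h1, h2]
  exact h'

end Boundary2

/-! The length of a current. -/

section Length

open Boundary2

variable {α : Type*} [DecidableEq α] {η : Measure (Boundary2 α)}
  {μ : Measure (Boundary α)}

theorem Corresponds.measure_cyl_self (h : Corresponds η μ) (u : FreeGroup α) :
    η (cyl u u) = μ Set.univ := by
  rw [h u u, inv_mul_cancel]
  congr 1
  ext x
  simp [Boundary.cyl, Boundary.initial]

variable [Finite α]

/-- Each geodesic passes through one of countably many vertices, and the geodesics through any given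
vertex have mass `μ Set.univ`. -/
theorem Corresponds.measure_univ_ne_zero (h : Corresponds η μ) (hη : η ≠ 0) :
    μ Set.univ ≠ 0 := by
  intro h0
  apply hη
  rw [← Measure.measure_univ_eq_zero]
  have : (Set.univ : Set (Boundary2 α)) ⊆ ⋃ u : FreeGroup α, cyl u u := fun z _ => by
    obtain ⟨n, h1, h2⟩ := exists_initial_eq_apply_ne z
    exact Set.mem_iUnion.mpr ⟨_, mem_cyl_of_initial h1 h2⟩
  have hc : Countable (FreeGroup α) := FreeGroup.toWord_injective.countable
  refine measure_mono_null this (measure_iUnion_null fun u => ?_)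
  rw [h.measure_cyl_self, h0]

theorem etaLength_eq (Φ : MulAut (FreeGroup α)) :
    etaLength η Φ = η (Boundary2.map Φ ⁻¹' baseBall α) :=
  Measure.map_apply (measurable_map Φ) isOpen_baseBall.measurableSet

/-- The first letter of `Φ x` depends only on the first `N` letters of `x`. So a geodesic sent into
the base-ball has ends that split within distance `N` of `1`, and it passes through one of finitely
many vertices. -/
theorem Corresponds.etaLength_lt_top (h : Corresponds η μ) (hμ : μ Set.univ < ∞)
    (Φ : MulAut (FreeGroup α)) : etaLength η Φ < ∞ := by
  obtain ⟨N, hN⟩ := Boundary.exists_initial_map Φ 1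
  have hsub : Boundary2.map Φ ⁻¹' baseBall α ⊆ ⋃ u ∈ {u : FreeGroup α | u.norm ≤ N}, cyl u u := by
    intro z hz
    obtain ⟨n, h1, h2⟩ := exists_initial_eq_apply_ne z
    refine Set.mem_biUnion ?_ (mem_cyl_of_initial h1 h2)
    rw [Set.mem_ofPred_eq, Boundary.norm_mk_initial]
    by_contra hn
    rw [Set.mem_preimage, baseBall_eq] at hz
    have h3 : (Boundary.map Φ z.1.1).initial 1 = (Boundary.map Φ z.1.2).initial 1 := by
      rw [hN, hN, ← Boundary.take_initial z.1.1 (not_le.mp hn).le, h1, Boundary.take_initial _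
        (not_le.mp hn).le]
    rw [Boundary.initial_one, Boundary.initial_one] at h3
    exact hz (List.singleton_injective h3)
  rw [etaLength_eq]
  refine (measure_mono hsub).trans_lt (measure_biUnion_lt_top (FreeGroup.finite_norm_le N) fun u _ => ?_)
  rw [h.measure_cyl_self]
  exact hμ

/-- An inner automorphism on the left of `Φ` can be moved to its right, where the invariance of `η`
absorbs it. -/
theorem IsGeodesicCurrent.map_conj_mul (h : IsGeodesicCurrent η) (v : FreeGroup α)
    (Φ : MulAut (FreeGroup α)) :
    η.map (Boundary2.map (MulAut.conj v * Φ)) = η.map (Boundary2.map Φ) := by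
  have h1 : MulAut.conj v * Φ = Φ * MulAut.conj (Φ⁻¹ v) := by
    ext x
    simp [MulAut.conj_apply]
  have h2 : Boundary2.map (MulAut.conj v * Φ) =
      Boundary2.map Φ ∘ Boundary2.map (MulAut.conj (Φ⁻¹ v)) := by
    funext z
    rw [h1, Boundary2.map_mul]
    rfl
  rw [h2, ← Measure.map_map (measurable_map _) (measurable_map _), h.invariant]

theorem IsGeodesicCurrent.map_map_conj (h : IsGeodesicCurrent η) (v : FreeGroup α)
    (Φ : MulAut (FreeGroup α)) :
    (η.map (Boundary2.map Φ)).map (Boundary2.map (MulAut.conj v)) = η.map (Boundary2.map Φ) := by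
  rw [Measure.map_map (measurable_map _) (measurable_map _)]
  conv_rhs => rw [← h.map_conj_mul v Φ]
  congr 1
  funext z
  exact (Boundary2.map_mul _ _ z).symm

theorem IsGeodesicCurrent.etaLength_conj_mul (h : IsGeodesicCurrent η) (v : FreeGroup α)
    (Φ : MulAut (FreeGroup α)) : etaLength η (MulAut.conj v * Φ) = etaLength η Φ := by
  rw [etaLength, h.map_conj_mul, etaLength]

end Length

/-! Vertices with several heavy directions. -/

theorem List.prefix_or_prefix_or_exists_branch {β : Type*} (U W : List β) :
    U <+: W ∨ W <+: U ∨ ∃ P a b U' W', a ≠ b ∧ U = P ++ a :: U' ∧ W = P ++ b :: W' := by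
  classical
  induction U generalizing W with
  | nil => exact Or.inl W.nil_prefix
  | cons a U ih =>
    cases W with
    | nil => exact Or.inr (Or.inl (List.nil_prefix))
    | cons b W =>
      by_cases hab : a = b
      · subst hab
        rcases ih W with h | h | ⟨P, c, d, U', W', h1, h2, h3⟩
        · exact Or.inl ((List.prefix_cons_inj a).mpr h)
        · exact Or.inr (Or.inl ((List.prefix_cons_inj a).mpr h))
        · exact Or.inr (Or.inr ⟨a :: P, c, d, U', W', h1, by simp [h2], by simp [h3]⟩)
      · exact Or.inr (Or.inr ⟨[], a, b, U, W, hab, rfl, rfl⟩)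

namespace FreeGroup

variable {α : Type*} [DecidableEq α]

theorem toWord_inv_mk_mul {u : FreeGroup α} {P U : List (α × Bool)} (h : u.toWord = P ++ U) :
    ((mk P)⁻¹ * u).toWord = U := by
  have hU : IsReduced U := (isReduced_toWord (x := u)).infix ⟨P, [], by simp [h]⟩
  rw [← mk_toWord (x := u), h, ← mul_mk, inv_mul_cancel_left, toWord_mk_of_isReduced hU]

/-- A reduced word does not backtrack: at the vertex `P`, the way back to `1` differs from the way
on. -/
theorem head?_inv_mk_ne {u : FreeGroup α} {P U : List (α × Bool)} {a : α × Bool}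
    (h : u.toWord = P ++ a :: U) : (mk P)⁻¹.toWord.head? ≠ some a := by
  have hP : IsReduced P := (isReduced_toWord (x := u)).infix ⟨[], a :: U, by simp [h]⟩
  have h1 := toWord_inv_mk_mul h
  have h2 : ((mk P)⁻¹⁻¹ * ((mk P)⁻¹ * u)).norm = (mk P)⁻¹.norm + ((mk P)⁻¹ * u).norm := by
    rw [inv_inv, mul_inv_cancel_left, norm_inv_eq, norm, norm, norm, h1, h,
      toWord_mk_of_isReduced hP, List.length_append]
  intro h3
  exact head_ne_of_norm_inv_mul h2 a h3 (by rw [h1]; rfl)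

/-- In a family of heavy directions compatible with the nesting of half-trees, an orbit of two
heavy directions under an automorphism forces a vertex with three heavy directions. -/
theorem exists_three_heavy [Nontrivial α] (H : FreeGroup α → α × Bool → Prop)
    (hH : ∀ g g' a a' s, H g' a → H g' a' → a ≠ a' → (g⁻¹ * g').toWord.head? = some s → H g s)
    (Ψ : MulAut (FreeGroup α)) {σ τ : α × Bool} (hστ : σ ≠ τ)
    (h : ∀ f : FreeGroup α, f.norm ≤ 2 → H (Ψ f) σ ∧ H (Ψ f) τ) :
    ∃ g a b c, a ≠ b ∧ a ≠ c ∧ b ≠ c ∧ H g a ∧ H g b ∧ H g c := by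
  by_contra! hno
  have hone : H 1 σ ∧ H 1 τ := by simpa using h 1 (by simp)
  -- A nearby orbit vertex in a third direction from `1` would make that direction heavy at `1`.
  have hhead : ∀ f s, f.norm ≤ 2 → (Ψ f).toWord.head? = some s → s = σ ∨ s = τ := by
    intro f s hf hs
    by_contra! hc
    exact hno 1 σ τ s hστ hc.1.symm hc.2.symm hone.1 hone.2
      (hH 1 (Ψ f) σ τ s (h f hf).1 (h f hf).2 hστ (by simpa using hs))
  -- If two orbit points on the same side of `1` branched, the branch vertex would have three heavy
  -- directions: back to `1` and towards each point. So they lie on one ray, where the distance to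
  -- `1` determines the point.
  have hcomp : ∀ f f' s, f.norm ≤ 2 → f'.norm ≤ 2 → (Ψ f).toWord.head? = some s →
      (Ψ f').toWord.head? = some s → (Ψ f).norm = (Ψ f').norm → f = f' := by
    intro f f' s hf hf' hs hs' hn
    apply Ψ.injective
    apply toWord_injective
    rcases List.prefix_or_prefix_or_exists_branch (Ψ f).toWord (Ψ f').toWord with
      h1 | h1 | ⟨P, a, b, U, W, hab, hU, hW⟩
    · exact h1.eq_of_length hn
    · exact (h1.eq_of_length hn.symm).symm
    · exfalso
      have hP : P ≠ [] := by
        rintro rfl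
        rw [hU] at hs
        rw [hW] at hs'
        simp only [List.nil_append, List.head?_cons, Option.some.injEq] at hs hs'
        exact hab (hs.trans hs'.symm)
      have hPr : IsReduced P := (isReduced_toWord (x := Ψ f)).infix ⟨[], a :: U, by simp [hU]⟩
      obtain ⟨c, hc⟩ : ∃ c, (mk P)⁻¹.toWord.head? = some c := by
        refine exists_head?_toWord fun h1 => hP ?_
        rw [inv_eq_one, ← toWord_eq_nil_iff, toWord_mk_of_isReduced hPr] at h1
        exact h1
      have hca : c ≠ a := fun e => head?_inv_mk_ne hU (e ▸ hc)
      have hcb : c ≠ b := fun e => head?_inv_mk_ne hW (e ▸ hc)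
      refine hno (mk P) c a b hca hcb hab
        (hH _ 1 σ τ c hone.1 hone.2 hστ (by simpa using hc))
        (hH _ (Ψ f) σ τ a (h f hf).1 (h f hf).2 hστ ?_)
        (hH _ (Ψ f') σ τ b (h f' hf').1 (h f' hf').2 hστ ?_)
      · rw [toWord_inv_mk_mul hU]; rfl
      · rw [toWord_inv_mk_mul hW]; rfl
  have hmul : ∀ (x y : FreeGroup α) (s : α × Bool), (Ψ x).toWord.head? = some s →
      (Ψ y).toWord.head? = some s → (Ψ x⁻¹).toWord.head? ≠ some s →
      (Ψ (x * y)).norm = (Ψ x).norm + (Ψ y).norm ∧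
        (Ψ (x * y)).toWord.head? = some s := by
    intro x y s hx hy hx'
    have h0 : ∀ a ∈ (Ψ x⁻¹).toWord.head?, a ∉ (Ψ y).toWord.head? := by
      intro a ha hb
      rw [hy] at hb
      rw [Option.mem_some] at hb
      exact hx' (hb ▸ ha)
    have h1 := norm_inv_mul_of_head_ne h0
    have h2 := toWord_inv_mul h0
    have h3 : (Ψ x⁻¹)⁻¹ * Ψ y = Ψ (x * y) := by simp
    rw [h3] at h1 h2
    refine ⟨by rw [h1, _root_.map_inv, norm_inv_eq], ?_⟩
    rw [h2, _root_.map_inv, toWord_inv, invRev_invRev, List.head?_append, hx]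
    rfl
  -- Neither product cancels, so `Ψ (x * y)` and `Ψ (y * x)` lie on the same side at the same
  -- distance and coincide. The products have length 2, hence the radius in the hypothesis `h`.
  have hcore : ∀ (x y : FreeGroup α) (s : α × Bool), x.norm ≤ 1 → y.norm ≤ 1 →
      (Ψ x).toWord.head? = some s → (Ψ y).toWord.head? = some s →
      (Ψ x⁻¹).toWord.head? ≠ some s → (Ψ y⁻¹).toWord.head? ≠ some s → Commute x y := by
    intro x y s hx hy h1 h2 h3 h4
    obtain ⟨h5, h6⟩ := hmul x y s h1 h2 h3
    obtain ⟨h7, h8⟩ := hmul y x s h2 h1 h4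
    refine hcomp (x * y) (y * x) s ?_ ?_ h6 h8 (by omega)
    · have := norm_mul_le x y; omega
    · have := norm_mul_le y x; omega
  -- A generator and its inverse have images of equal length; on the same side they would coincide.
  have hgen : ∀ s : α, ∃ p q, p ≠ q ∧ (p = σ ∨ p = τ) ∧ (q = σ ∨ q = τ) ∧
      (Ψ (of s)).toWord.head? = some p ∧ (Ψ (of s)⁻¹).toWord.head? = some q := by
    intro s
    have hs : Ψ (of s) ≠ 1 := by simp
    have hs' : Ψ (of s)⁻¹ ≠ 1 := by simp
    obtain ⟨p, hp⟩ := exists_head?_toWord hs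
    obtain ⟨q, hq⟩ := exists_head?_toWord hs'
    have hn : (of s).norm ≤ 2 := by simp
    have hn' : (of s)⁻¹.norm ≤ 2 := by simp
    refine ⟨p, q, ?_, hhead _ p hn hp, hhead _ q hn' hq, hp, hq⟩
    rintro rfl
    have := hcomp _ _ p hn hn' hp hq (by rw [_root_.map_inv, norm_inv_eq])
    rw [← toWord_inj, toWord_inv, toWord_of] at this
    simp [invRev] at this
  obtain ⟨s, t, hst⟩ := exists_pair_ne α
  have hncomm : ¬ Commute (of s) (of t) := by
    intro hc
    have := congrArg toWord hc.eq
    have hr : ∀ s t : α, (of s * of t).toWord = [(s, true), (t, true)] := by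
      intro s t
      rw [of, of, mul_mk]
      exact toWord_mk_of_isReduced (by simp [IsReduced])
    rw [hr, hr] at this
    simp at this
    exact hst this.1
  obtain ⟨p, q, hpq, hp, hq, hp', hq'⟩ := hgen s
  obtain ⟨p₁, q₁, hpq₁, hp₁, hq₁, hp₁', hq₁'⟩ := hgen t
  have hns : (of s).norm ≤ 1 := by simp
  have hns' : (of s)⁻¹.norm ≤ 1 := by simp
  have hnt : (of t).norm ≤ 1 := by simp
  have hsome : ∀ {o : Option (α × Bool)} {a b : α × Bool}, o = some a → a ≠ b → o ≠ some b := by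
    rintro o a b rfl h1 h2
    exact h1 (Option.some_injective _ h2)
  by_cases hpp : p = p₁
  · subst hpp
    exact hncomm (hcore _ _ p hns hnt hp' hp₁' (hsome hq' hpq.symm) (hsome hq₁' hpq₁.symm))
  -- Only two sides are available, so replacing the first generator by its inverse puts both images
  -- on the same side.
  · have hqp : q = p₁ := by
      clear * - hp hq hp₁ hpq hpp
      grind
    subst hqp
    refine hncomm ?_
    have := hcore _ _ q hns' hnt hq' hp₁' (by rw [inv_inv]; exact hsome hp' hpq)
      (hsome hq₁' hpq₁.symm)
    exact Commute.inv_left_iff.mp this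

end FreeGroup

/-! ### Heavy directions of a quasi-invariant measure. -/

namespace Boundary

variable {α : Type*} [Finite α] [DecidableEq α] {ν : Measure (Boundary α)}

theorem exists_div_card_le_dirSet [Nonempty α] (g : FreeGroup α) :
    ∃ a, ν Set.univ / Nat.card (α × Bool) ≤ ν (dirSet g a) := by
  have := Fintype.ofFinite (α × Bool)
  have hcard : (Nat.card (α × Bool) : ℝ≥0∞) ≠ 0 := by
    simp
  have h1 : ν Set.univ ≤ ∑ a, ν (dirSet g a) := by
    have : (Set.univ : Set (Boundary α)) = ⋃ a, dirSet g a := by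
      ext x; simp [dirSet]
    rw [this]
    exact measure_iUnion_fintype_le ν _
  have h2 : ∑ _a : α × Bool, ν Set.univ / Nat.card (α × Bool) ≤ ∑ a, ν (dirSet g a) := by
    rw [Finset.sum_const, Finset.card_univ, ← Nat.card_eq_fintype_card, nsmul_eq_mul,
      ENNReal.mul_div_cancel hcard (by simp)]
    exact h1
  obtain ⟨a, -, ha⟩ := ENNReal.exists_le_of_sum_le Finset.univ_nonempty h2
  exact ⟨a, ha⟩

/-- At most one of the two directions at `g'` points back to `g`; the half-tree of the other lies
beyond `g'` as seen from `g`. -/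
theorem le_dirSet_of_head? {δ : ℝ≥0∞} {g g' : FreeGroup α} {a a' s : α × Bool}
    (ha : δ ≤ ν (dirSet g' a)) (ha' : δ ≤ ν (dirSet g' a')) (haa : a ≠ a')
    (hs : (g⁻¹ * g').toWord.head? = some s) : δ ≤ ν (dirSet g s) := by
  by_cases h : (g'⁻¹ * g).toWord.head? = some a
  · refine ha'.trans (measure_mono (dirSet_subset_dirSet hs ?_))
    rw [h]
    exact fun e => haa (Option.some_injective _ e)
  · exact ha.trans (measure_mono (dirSet_subset_dirSet hs h))

variable {Φ : MulAut (FreeGroup α)} {β : ℝ≥0∞}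

theorem exists_two_heavy [Nontrivial α] (hβ : β ≤ 1)
    (h : ∀ f : FreeGroup α, f.norm ≤ 2 → ∀ g a, β * ν (dirSet g a) ≤ ν (dirSet (Φ f * g) a)) :
    ∃ g a a', a ≠ a' ∧ β * (ν Set.univ / Nat.card (α × Bool)) ≤ ν (dirSet g a) ∧
      β * (ν Set.univ / Nat.card (α × Bool)) ≤ ν (dirSet g a') := by
  by_contra! hno
  set t := ν Set.univ / Nat.card (α × Bool)
  choose σ hσ using exists_div_card_le_dirSet (ν := ν)
  have hle : β * t ≤ t := mul_le_of_le_one_left' hβ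
  have huniq : ∀ g a a', β * t ≤ ν (dirSet g a) → β * t ≤ ν (dirSet g a') → a = a' := by
    intro g a a' h1 h2
    by_contra hc
    exact absurd h2 (not_le.mpr (hno g a a' hc h1))
  -- Translation by `Φ f` costs a factor `β`, so the direction of mass at least `t` stays above `β *
  -- t` and is the unique one there.
  have hstep : ∀ f : FreeGroup α, f.norm ≤ 2 → ∀ g, σ (Φ f * g) = σ g := fun f hf g =>
    huniq _ _ _ (hle.trans (hσ _)) ((mul_le_mul_right (hσ g) β).trans (h f hf g _))
  have hall : ∀ f g : FreeGroup α, σ (Φ f * g) = σ g := by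
    intro f
    induction f using FreeGroup.induction_on with
    | C1 => simp
    | of s => exact hstep _ (by simp)
    | inv_of s _ => exact hstep _ (by simp)
    | mul x y hx hy => intro g; rw [_root_.map_mul, mul_assoc, hx, hy]
  have hconst : ∀ g, σ g = σ 1 := fun g => by
    simpa using hall (Φ⁻¹ g) 1
  -- A generator other than that of the constant direction: from the vertex `t'` the constant
  -- direction does not lead back to `1`, so its half-tree lies in the direction `t'` at `1`, giving
  -- a second heavy direction there.
  obtain ⟨t', ht'⟩ := exists_ne (σ 1).1
  have hsub : dirSet (FreeGroup.of t') (σ 1) ⊆ dirSet 1 (t', true) := by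
    refine dirSet_subset_dirSet (by simp) ?_
    simp only [mul_one, FreeGroup.toWord_inv, FreeGroup.toWord_of, FreeGroup.invRev]
    intro h0
    have := Option.some_injective _ h0
    exact ht' (congrArg Prod.fst this)
  have h1 := huniq 1 (t', true) (σ 1)
    (hle.trans ((hconst (FreeGroup.of t') ▸ hσ (FreeGroup.of t')).trans (measure_mono hsub)))
    (hle.trans (hσ 1))
  exact ht' (congrArg Prod.fst h1)

theorem exists_three_heavy [Nontrivial α] (hβ : β ≤ 1)
    (h : ∀ f : FreeGroup α, f.norm ≤ 2 → ∀ g a, β * ν (dirSet g a) ≤ ν (dirSet (Φ f * g) a)) :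
    ∃ g a₁ a₂ a₃, a₁ ≠ a₂ ∧ a₁ ≠ a₃ ∧ a₂ ≠ a₃ ∧
      ∀ a ∈ ({a₁, a₂, a₃} : Set (α × Bool)),
        β * (β * (ν Set.univ / Nat.card (α × Bool))) ≤ ν (dirSet g a) := by
  obtain ⟨x, σ, τ, hστ, hσ, hτ⟩ := exists_two_heavy hβ h
  set δ := β * (β * (ν Set.univ / Nat.card (α × Bool)))
  obtain ⟨g, a₁, a₂, a₃, h1, h2, h3, h4, h5, h6⟩ := FreeGroup.exists_three_heavy
    (fun u a => δ ≤ ν (dirSet (x * u) a))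
    (fun g g' a a' s ha ha' haa hs => le_dirSet_of_head? ha ha' haa (by
      rwa [mul_inv_rev, mul_assoc, inv_mul_cancel_left]))
    -- Recentring at `x` turns the orbit points `Φ f * x` into images of `f`; moving the two heavy
    -- directions along the orbit costs the second factor `β`.
    (MulAut.conj x⁻¹ * Φ) hστ (fun f hf => by
      have : x * (MulAut.conj x⁻¹ * Φ) f = Φ f * x := by
        simp [mul_assoc]
      rw [this]
      exact ⟨(mul_le_mul_right hσ β).trans (h f hf x σ), (mul_le_mul_right hτ β).trans (h f hf x τ)⟩)
  refine ⟨x * g, a₁, a₂, a₃, h1, h2, h3, ?_⟩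
  rintro a (rfl | rfl | rfl)
  exacts [h4, h5, h6]

end Boundary

/-! Long heavy cylinders force a large length. -/

namespace Boundary2

open Boundary

variable {α : Type*} [Finite α] [DecidableEq α]

/-- The translate, by the inverse of the initial segment of length `k` of `v`, of the set of
geodesics that come from the direction `a` and run through `v`. -/
def branchSet (v : FreeGroup α) (a : α × Bool) (k : ℕ) : Set (Boundary2 α) :=
  map (MulAut.conj (FreeGroup.mk (v.toWord.take k))) ⁻¹' prod {x | x.1 0 = a} (Boundary.cyl v)

theorem measurableSet_branchSet (v : FreeGroup α) (a : α × Bool) (k : ℕ) :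
    MeasurableSet (branchSet v a k) :=
  measurable_map _ (measurableSet_prod (isOpen_letter_eq a).measurableSet
    (isOpen_cyl v).measurableSet)

variable {v : FreeGroup α} {a b : α × Bool} {k l : ℕ}

/-- Seen from the `k`-th vertex of `v`, the geodesic runs back along `v` to its start and leaves by
`a`, while its other end follows the rest of `v`. -/
theorem letters_of_mem_branchSet (ha : v.toWord.head? ≠ some a) (hk : k ≤ v.norm)
    {z : Boundary2 α} (hz : z ∈ branchSet v a k) :
    z.1.1.1 k = a ∧
    (∀ j < k, v.toWord[j]? = some ((z.1.1.1 (k - 1 - j)).1, !(z.1.1.1 (k - 1 - j)).2)) ∧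
    ∀ j, k ≤ j → j < v.norm → v.toWord[j]? = some (z.1.2.1 (j - k)) := by
  set V := v.toWord with hV
  set g := FreeGroup.mk (V.take k) with hg
  have hlen : k ≤ V.length := hk
  have hgw : g.toWord = V.take k := FreeGroup.toWord_mk_of_isReduced
    ((FreeGroup.isReduced_toWord (x := v)).infix (V.take_prefix k).isInfix)
  have hgn : g.norm = k := by
    rw [FreeGroup.norm, hgw, List.length_take, min_eq_left hlen]
  obtain ⟨hx, hy⟩ := hz
  set x := Boundary.map (MulAut.conj g) z.1.1 with hxdef
  set y := Boundary.map (MulAut.conj g) z.1.2 with hydef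
  have hx' : x.1 0 = a := hx
  have hy' : y.initial V.length = V := hy
  have hz1 : z.1.1 = Boundary.map (MulAut.conj g⁻¹) x := by
    rw [hxdef, _root_.map_inv, map_inv_map]
  have hz2 : z.1.2 = Boundary.map (MulAut.conj g⁻¹) y := by
    rw [hydef, _root_.map_inv, map_inv_map]
  have hred : FreeGroup.IsReduced (g⁻¹.toWord ++ [x.1 0]) := by
    refine FreeGroup.head?_toWord_inv_ne ?_
    rw [inv_inv, hgw, hx', List.head?_take]
    split_ifs
    · simp
    · exact ha
  have hgn' : g⁻¹.norm = k := by rw [FreeGroup.norm_inv_eq, hgn]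
  refine ⟨?_, fun j hj => ?_, fun j hkj hj => ?_⟩
  · have := map_conj_apply_norm_add hred 0
    rw [hgn', add_zero, hx', ← hz1] at this
    exact this
  · have h1 := map_conj_initial_norm hred
    rw [← hz1, hgn', FreeGroup.toWord_inv, hgw] at h1
    have h2 := congrArg FreeGroup.invRev h1
    rw [FreeGroup.invRev_invRev] at h2
    have h3 : V[j]? = (V.take k)[j]? := by rw [List.getElem?_take_of_lt hj]
    rw [h3, ← h2, FreeGroup.invRev, List.getElem?_reverse (by simpa [length_initial] using hj),
      List.length_map, length_initial, List.getElem?_map, initial, List.getElem?_map,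
      List.getElem?_range (by omega)]
    rfl
  · have h1 : y ∈ Boundary.cyl g := by
      change y.initial g.norm = g.toWord
      rw [hgn, hgw, ← hy', take_initial y hlen]
    have h2 := map_conj_inv_apply h1 (j - k)
    rw [← hz2, hgn, Nat.add_sub_cancel' hkj] at h2
    have hj' : j < V.length := hj
    rw [h2, ← hy', initial, List.getElem?_map, List.getElem?_range hj']
    rfl

/-- A geodesic in both sets reads `v` at two positions shifted by `l - k`, so `v` has that period;
the edge where one copy leaves by `a` is read backwards as a letter of the other. -/
theorem periodic_of_mem_branchSet (ha : v.toWord.head? ≠ some a) (hkl : k < l) (hl : l ≤ v.norm)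
    {z : Boundary2 α} (hzk : z ∈ branchSet v a k) (hzl : z ∈ branchSet v a l) :
    v.toWord[l - k - 1]? = some (a.1, !a.2) ∧
      ∀ j, j + (l - k) < v.norm → v.toWord[j + (l - k)]? = v.toWord[j]? := by
  obtain ⟨h1, h2, h3⟩ := letters_of_mem_branchSet ha (hkl.le.trans hl) hzk
  obtain ⟨-, h5, h6⟩ := letters_of_mem_branchSet ha hl hzl
  refine ⟨?_, fun j hj => ?_⟩
  · rw [h5 _ (by omega), show l - 1 - (l - k - 1) = k by omega, h1]
  · rcases lt_or_ge j k with hjk | hjk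
    · rw [h5 _ (by omega), h2 _ hjk, show l - 1 - (j + (l - k)) = k - 1 - j by omega]
    · rw [h6 _ (by omega) hj, h3 _ hjk (by omega), show j + (l - k) - l = j - k by omega]

theorem branchSet_subset_baseBall (ha : v.toWord.head? ≠ some a) (hk0 : k ≠ 0)
    (hk : k < v.norm) : branchSet v a k ⊆ baseBall α := by
  intro z hz
  obtain ⟨-, h2, h3⟩ := letters_of_mem_branchSet ha hk.le hz
  rw [baseBall_eq]
  intro h0
  have e1 := h2 (k - 1) (by omega)
  have e2 := h3 k le_rfl hk
  rw [Nat.sub_self] at e1 e2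
  rw [h0] at e1
  have hr := FreeGroup.isReduced_toWord (x := v)
  rw [FreeGroup.IsReduced, List.isChain_iff_getElem] at hr
  have hk' : k < v.toWord.length := hk
  have h4 := hr (k - 1) (by omega)
  rw [List.getElem?_eq_getElem (by omega), Option.some.injEq] at e1 e2
  simp only [Nat.sub_add_cancel (Nat.pos_of_ne_zero hk0), e1, e2] at h4
  simp at h4

/-- If both families overlapped, `v` would have periods `d` and `d'` with letters `a⁻¹` and `b⁻¹` at
positions `d - 1` and `d' - 1`. Both letters then recur at `d + d' - 1`, which is inside `v` because
`d` and `d'` are at most half its length; so `a = b`. -/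
theorem pairwiseDisjoint_branchSet_or (ha : v.toWord.head? ≠ some a)
    (hb : v.toWord.head? ≠ some b) (hab : a ≠ b) :
    (↑(Finset.Icc 1 (v.norm / 2)) : Set ℕ).PairwiseDisjoint (branchSet v a) ∨
      (↑(Finset.Icc 1 (v.norm / 2)) : Set ℕ).PairwiseDisjoint (branchSet v b) := by
  by_contra! hc
  have key : ∀ c : α × Bool, v.toWord.head? ≠ some c →
      ¬ (↑(Finset.Icc 1 (v.norm / 2)) : Set ℕ).PairwiseDisjoint (branchSet v c) →
      ∃ d, 0 < d ∧ d ≤ v.norm / 2 ∧ v.toWord[d - 1]? = some (c.1, !c.2) ∧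
        ∀ j, j + d < v.norm → v.toWord[j + d]? = v.toWord[j]? := by
    intro c hc h
    simp only [Set.PairwiseDisjoint, Set.Pairwise, not_forall] at h
    obtain ⟨k, hk, l, hl, hkl, h⟩ := h
    obtain ⟨z, hzk, hzl⟩ := Set.not_disjoint_iff.mp h
    simp only [Finset.coe_Icc, Set.mem_Icc] at hk hl
    rcases lt_or_gt_of_ne hkl with hlt | hlt
    · exact ⟨l - k, by omega, by omega, periodic_of_mem_branchSet hc hlt (by omega) hzk hzl⟩
    · exact ⟨k - l, by omega, by omega, periodic_of_mem_branchSet hc hlt (by omega) hzl hzk⟩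
  obtain ⟨d, h1, h2, h3, h4⟩ := key a ha hc.1
  obtain ⟨d', h1', h2', h3', h4'⟩ := key b hb hc.2
  have e1 := h4 (d' - 1) (by omega)
  have e2 := h4' (d - 1) (by omega)
  rw [show d' - 1 + d = d - 1 + d' by omega, e2, h3, h3'] at e1
  have e3 := Option.some_injective _ e1
  simp only [Prod.mk.injEq, Bool.not_inj_iff] at e3
  exact hab (Prod.ext e3.1 e3.2)

theorem norm_mul_le_measure_baseBall {ζ : Measure (Boundary2 α)} {ν : Measure (Boundary α)}
    {c δ m : ℝ≥0∞} (hinv : ∀ f : FreeGroup α, ζ.map (map (MulAut.conj f)) = ζ)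
    (hprod : ∀ E S : Set (Boundary α), MeasurableSet E → MeasurableSet S → Disjoint E S →
      c * (ν E * ν S) ≤ ζ (prod E S))
    (ha : v.toWord.head? ≠ some a) (hb : v.toWord.head? ≠ some b) (hab : a ≠ b)
    (hνa : δ ≤ ν {x | x.1 0 = a}) (hνb : δ ≤ ν {x | x.1 0 = b}) (hνv : m ≤ ν (Boundary.cyl v)) :
    ((v.norm / 2 : ℕ) : ℝ≥0∞) * (c * (δ * m)) ≤ ζ (baseBall α) := by
  rcases eq_or_ne (v.norm / 2) 0 with h0 | h0
  · simp [h0]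
  have hv : v.norm ≠ 0 := by omega
  have key : ∀ e : α × Bool, v.toWord.head? ≠ some e → δ ≤ ν {x | x.1 0 = e} →
      (↑(Finset.Icc 1 (v.norm / 2)) : Set ℕ).PairwiseDisjoint (branchSet v e) →
      ((v.norm / 2 : ℕ) : ℝ≥0∞) * (c * (δ * m)) ≤ ζ (baseBall α) := by
    intro e he hνe hd
    have hdis : Disjoint {x : Boundary α | x.1 0 = e} (Boundary.cyl v) := by
      refine Set.disjoint_left.mpr fun x hx hx' => he ?_
      rw [← show x.initial v.norm = v.toWord from hx', head?_initial x hv]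
      exact congrArg some hx
    have h1 : ∀ k, c * (δ * m) ≤ ζ (branchSet v e k) := fun k => by
      have hE := (isOpen_letter_eq e).measurableSet
      have hS := (isOpen_cyl v).measurableSet
      rw [branchSet, ← Measure.map_apply (measurable_map _) (measurableSet_prod hE hS), hinv]
      exact le_trans (by gcongr) (hprod _ _ hE hS hdis)
    calc ((v.norm / 2 : ℕ) : ℝ≥0∞) * (c * (δ * m))
        = ∑ _k ∈ Finset.Icc 1 (v.norm / 2), c * (δ * m) := by simp
      _ ≤ ∑ k ∈ Finset.Icc 1 (v.norm / 2), ζ (branchSet v e k) := by gcongr; exact h1 _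
      _ = ζ (⋃ k ∈ Finset.Icc 1 (v.norm / 2), branchSet v e k) :=
        (measure_biUnion_finset hd fun k _ => measurableSet_branchSet v e k).symm
      _ ≤ ζ (baseBall α) := by
        refine measure_mono (Set.iUnion₂_subset fun k hk => ?_)
        rw [Finset.mem_Icc] at hk
        exact branchSet_subset_baseBall he (by omega) (by omega)
  rcases pairwiseDisjoint_branchSet_or ha hb hab with h | h
  · exact key a ha hνa h
  · exact key b hb hνb h

end Boundary2

/-! Length compactness. -/

namespace FreeGroup

variable {α : Type*} [DecidableEq α]

theorem finite_mulAut_norm_le [Finite α] (R : ℕ) :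
    {Ψ : MulAut (FreeGroup α) | ∀ s, (Ψ (of s)).norm ≤ R}.Finite := by
  have h1 : {h : α → FreeGroup α | ∀ s, h s ∈ {u : FreeGroup α | u.norm ≤ R}}.Finite :=
    Set.Finite.pi' fun _ => finite_norm_le R
  refine h1.preimage (f := fun (Ψ : MulAut (FreeGroup α)) s => Ψ (of s)) fun Ψ _ Ψ' _ h => ?_
  apply MulEquiv.toMonoidHom_injective
  ext s
  exact congrFun h s

/-- In rank one, `Φ` and `Φ⁻¹` act by integer exponents with product 1. -/
theorem norm_mulAut_of_le_one [Subsingleton α] (Φ : MulAut (FreeGroup α)) (s : α) :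
    (Φ (of s)).norm ≤ 1 := by
  have hz : ∀ x : FreeGroup α, ∃ k : ℤ, of s ^ k = x := by
    intro x
    rw [← Subgroup.mem_zpowers_iff]
    induction x using FreeGroup.induction_on with
    | C1 => exact one_mem _
    | of t => exact Subsingleton.elim s t ▸ Subgroup.mem_zpowers _
    | inv_of t ht => exact inv_mem ht
    | mul x y hx hy => exact mul_mem hx hy
  have hnorm : ∀ k : ℤ, (of s ^ k).norm = k.natAbs := by
    intro k
    obtain ⟨n, rfl | rfl⟩ := k.eq_nat_or_neg
    · rw [zpow_natCast, norm_of_pow, Int.natAbs_natCast]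
    · rw [zpow_neg, zpow_natCast, norm_inv_eq, norm_of_pow, Int.natAbs_neg, Int.natAbs_natCast]
  obtain ⟨k, hk⟩ := hz (Φ (of s))
  obtain ⟨j, hj⟩ := hz (Φ⁻¹ (of s))
  have h1 : of s ^ (k * j) = of s := by
    rw [zpow_mul, hk, ← map_zpow, hj]
    simp
  have h2 := hnorm (k * j)
  rw [h1, norm_of, Int.natAbs_mul] at h2
  rw [← hk, hnorm, Nat.eq_one_of_mul_eq_one_right h2.symm]

end FreeGroup

section Compactness

variable {α : Type*} [Finite α] [DecidableEq α] {η : Measure (Boundary2 α)}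
  {μ : Measure (Boundary α)}

open Boundary

theorem exists_uniform_quasi_invariance {b : FreeGroup α → ℝ≥0} (hb : ∀ f, 0 < b f) (N : ℕ) :
    ∃ β : ℝ≥0, 0 < β ∧ β ≤ 1 ∧ ∀ f : FreeGroup α, f.norm ≤ N → β ≤ b f := by
  obtain ⟨f₀, -, h⟩ := Set.exists_min_image _ b (FreeGroup.finite_norm_le (α := α) N)
    ⟨1, by simp⟩
  exact ⟨min 1 (b f₀), lt_min one_pos (hb f₀), min_le_left _ _,
    fun f hf => (min_le_right _ _).trans (h f hf)⟩

/-- The image of `μ` under `Φ` is quasi-invariant under the action twisted by `Φ`. -/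
theorem map_quasi_invariant {f : FreeGroup α} {β : ℝ≥0∞}
    (hquasi : ∀ E : Set (Boundary α), MeasurableSet E →
      β * μ E ≤ μ (Boundary.map (MulAut.conj f) '' E))
    (Φ : MulAut (FreeGroup α)) {E : Set (Boundary α)} (hE : MeasurableSet E) :
    β * μ.map (Boundary.map Φ) E ≤
      μ.map (Boundary.map Φ) (Boundary.map (MulAut.conj (Φ f)⁻¹) ⁻¹' E) := by
  have hΦ := (Boundary.continuous_map Φ).measurable
  have hf := (Boundary.continuous_map (MulAut.conj (Φ f)⁻¹)).measurable
  rw [Measure.map_apply hΦ hE, Measure.map_apply hΦ (hf hE)]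
  refine (hquasi _ (hΦ hE)).trans (measure_mono ?_)
  rintro _ ⟨x, hx, rfl⟩
  simp only [Set.mem_preimage] at hx ⊢
  rw [← Boundary.map_mul, ← Boundary.map_mul]
  -- The extension of `Φ` intertwines the action of `f` with that of `Φ f`.
  have : MulAut.conj (Φ f)⁻¹ * Φ * MulAut.conj f = Φ := by
    ext x
    simp [MulAut.conj_apply, mul_assoc]
  rwa [this]

theorem map_prod_le {c : ℝ≥0∞}
    (hprod : ∀ E S : Set (Boundary α), MeasurableSet E → MeasurableSet S → Disjoint E S →
      c * (μ E * μ S) ≤ η (Boundary2.prod E S))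
    (Φ : MulAut (FreeGroup α)) {E S : Set (Boundary α)} (hE : MeasurableSet E)
    (hS : MeasurableSet S) (hES : Disjoint E S) :
    c * (μ.map (Boundary.map Φ) E * μ.map (Boundary.map Φ) S) ≤
      η.map (Boundary2.map Φ) (Boundary2.prod E S) := by
  have hΦ := (Boundary.continuous_map Φ).measurable
  rw [Measure.map_apply hΦ hE, Measure.map_apply hΦ hS,
    Measure.map_apply (Boundary2.measurable_map Φ) (Boundary2.measurableSet_prod hE hS)]
  exact hprod _ _ (hΦ hE) (hΦ hS) (hES.preimage _)

/-- An automorphism of bounded `η`-length has, up to inner automorphisms, generators of bounded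
length. -/
theorem exists_norm_conj_le (hη : IsGeodesicCurrent η) (hη0 : η ≠ 0)
    (hημ : Corresponds η μ) {c : ℝ≥0} (hc : 0 < c) {b : FreeGroup α → ℝ≥0} (hb : ∀ f, 0 < b f)
    (hquasi : ∀ f : FreeGroup α, ∀ E : Set (Boundary α), MeasurableSet E →
      (b f : ℝ≥0∞) * μ E ≤ μ (Boundary.map (MulAut.conj f) '' E))
    (hprod : ∀ E S : Set (Boundary α), MeasurableSet E → MeasurableSet S → Disjoint E S →
      (c : ℝ≥0∞) * (μ E * μ S) ≤ η (Boundary2.prod E S)) (M : ℝ≥0) :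
    ∃ R : ℕ, ∀ Φ : MulAut (FreeGroup α), etaLength η Φ ≤ M →
      ∃ g : FreeGroup α, ∀ s, ((MulAut.conj g * Φ) (FreeGroup.of s)).norm ≤ R := by
  rcases subsingleton_or_nontrivial α with hα | hα
  · exact ⟨1, fun Φ _ => ⟨1, fun s => FreeGroup.norm_mulAut_of_le_one _ s⟩⟩
  obtain ⟨β, hβ0, hβ1, hβ⟩ := exists_uniform_quasi_invariance hb 2
  have hβ1' : (β : ℝ≥0∞) ≤ 1 := by exact_mod_cast hβ1
  have hβ0' : (β : ℝ≥0∞) ≠ 0 := by exact_mod_cast hβ0.ne'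
  have hc0' : (c : ℝ≥0∞) ≠ 0 := by exact_mod_cast hc.ne'
  have hquasi' : ∀ f : FreeGroup α, f.norm ≤ 2 → ∀ E : Set (Boundary α), MeasurableSet E →
      (β : ℝ≥0∞) * μ E ≤ μ (Boundary.map (MulAut.conj f) '' E) := fun f hf E hE =>
    le_trans (by gcongr; exact hβ f hf) (hquasi f E hE)
  set δ : ℝ≥0∞ := β * (β * (μ Set.univ / Nat.card (α × Bool))) with hδ
  have hδ0 : δ ≠ 0 := mul_ne_zero hβ0' (mul_ne_zero hβ0'
    (ENNReal.div_ne_zero.mpr ⟨hημ.measure_univ_ne_zero hη0, ENNReal.natCast_ne_top _⟩))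
  -- `c * (δ * (β * δ))` is the mass of one translated copy: `δ` for the incoming direction, `β * δ`
  -- for the cylinder of `v`. More than `M` cannot fit, so fewer than `K` copies do.
  obtain ⟨K, hK⟩ := ENNReal.exists_nat_mul_gt (a := c * (δ * (β * δ))) (b := M)
    (mul_ne_zero hc0' (mul_ne_zero hδ0 (mul_ne_zero hβ0' hδ0))) ENNReal.coe_ne_top
  refine ⟨2 * K, fun Φ hΦ => ?_⟩
  have hm := (Boundary.continuous_map Φ).measurable
  have huniv : μ.map (Boundary.map Φ) Set.univ = μ Set.univ := by
    rw [Measure.map_apply hm MeasurableSet.univ, Set.preimage_univ]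
  obtain ⟨g, a₁, a₂, a₃, h12, h13, h23, hheavy⟩ := Boundary.exists_three_heavy
    (ν := μ.map (Boundary.map Φ)) (Φ := Φ) hβ1' (fun f hf g a => by
      rw [dirSet_mul]
      exact map_quasi_invariant (hquasi' f hf) Φ (isOpen_dirSet g a).measurableSet)
  rw [huniv, ← hδ] at hheavy
  -- Conjugating by `g⁻¹` moves the vertex with three heavy directions to `1`.
  refine ⟨g⁻¹, fun s => ?_⟩
  set Ψ := MulAut.conj g⁻¹ * Φ with hΨ
  have hmΨ := (Boundary.continuous_map Ψ).measurable
  have hdir : ∀ a ∈ ({a₁, a₂, a₃} : Set (α × Bool)),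
      δ ≤ μ.map (Boundary.map Ψ) {x | x.1 0 = a} := by
    intro a ha
    refine (hheavy a ha).trans_eq ?_
    rw [Measure.map_apply hm (isOpen_dirSet g a).measurableSet,
      Measure.map_apply hmΨ (isOpen_letter_eq a).measurableSet]
    congr 1
    ext x
    simp only [Set.mem_preimage, dirSet, Set.mem_ofPred_eq]
    rw [hΨ, Boundary.map_mul]
  set v := Ψ (FreeGroup.of s)
  have hpick : ∀ o : Option (α × Bool), ∃ a ∈ ({a₁, a₂, a₃} : Set (α × Bool)),
      ∃ a' ∈ ({a₁, a₂, a₃} : Set (α × Bool)), a ≠ a' ∧ o ≠ some a ∧ o ≠ some a' := by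
    intro o
    by_cases h1 : o = some a₁
    · exact ⟨a₂, by simp, a₃, by simp, h23, by simpa [h1] using h12, by simpa [h1] using h13⟩
    by_cases h2 : o = some a₂
    · exact ⟨a₁, by simp, a₃, by simp, h13, h1, by simpa [h2] using h23⟩
    · exact ⟨a₁, by simp, a₂, by simp, h12, h1, h2⟩
  -- A heavy direction that does not cancel against `v` is translated by `v` into its cylinder, at
  -- the cost of `β`.
  have hcyl : β * δ ≤ μ.map (Boundary.map Ψ) (Boundary.cyl v) := by
    obtain ⟨a, ha, -, -, -, hne, -⟩ := hpick v⁻¹.toWord.head?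
    have h1 : β * δ ≤ β * μ.map (Boundary.map Ψ) {x | x.1 0 = a} := by
      gcongr
      exact hdir a ha
    refine h1.trans ((map_quasi_invariant (hquasi' (FreeGroup.of s) (by simp)) Ψ
      (isOpen_letter_eq a).measurableSet).trans (measure_mono fun x hx => ?_))
    have h2 : v⁻¹.toWord.head? ≠ some ((Boundary.map (MulAut.conj v⁻¹) x).1 0) := by
      rw [show (Boundary.map (MulAut.conj v⁻¹) x).1 0 = a from hx]
      exact hne
    have h3 := map_conj_mem_cyl h2
    rwa [_root_.map_inv, map_map_inv] at h3
  obtain ⟨a, ha, a', ha', haa, hne, hne'⟩ := hpick v.toWord.head?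
  have hfin := Boundary2.norm_mul_le_measure_baseBall
    (ζ := η.map (Boundary2.map Ψ)) (ν := μ.map (Boundary.map Ψ)) (c := c)
    (fun f => hη.map_map_conj f Ψ) (fun E S hE hS hES => map_prod_le hprod Ψ hE hS hES)
    hne hne' haa (hdir a ha) (hdir a' ha') hcyl
  have hlen : η.map (Boundary2.map Ψ) (Boundary2.baseBall α) ≤ M :=
    (hη.etaLength_conj_mul g⁻¹ Φ).trans_le hΦ
  have hlt := (hfin.trans hlen).trans_lt hK
  have : v.norm / 2 < K := by
    by_contra! hKle
    exact absurd hlt (not_lt.mpr (by gcongr))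
  omega

end Compactness

theorem theorem5p2 {α : Type*} [Finite α] [DecidableEq α]
    (η : Measure (Boundary2 α)) (hη : IsGeodesicCurrent η) (hη0 : η ≠ 0)
    (μ : Measure (Boundary α)) (hμ : IsFrequencyMeasure μ) (hημ : Corresponds η μ)
    (c : ℝ≥0) (hc : 0 < c)
    (b : FreeGroup α → ℝ≥0) (hb : ∀ f, 0 < b f)
    (hquasi : ∀ f : FreeGroup α, ∀ E : Set (Boundary α), MeasurableSet E →
      (b f : ℝ≥0∞) * μ E ≤ μ (Boundary.map (MulAut.conj f) '' E))
    (hprod : ∀ E S : Set (Boundary α), MeasurableSet E → MeasurableSet S → Disjoint E S →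
      (c : ℝ≥0∞) * (μ E * μ S) ≤ η (Boundary2.prod E S)) :
    (∀ Φ : ℕ → MulAut (FreeGroup α),
      (∃ M : ℝ≥0, ∀ n, etaLength η (Φ n) ≤ M) →
      ∃ φ : ℕ → ℕ, StrictMono φ ∧ ∃ v : ℕ → FreeGroup α, ∃ Ψ : MulAut (FreeGroup α),
        ∀ n, MulAut.conj (v n) * Φ (φ n) = Ψ) ∧
    (∀ Φ : ℕ → MulAut (FreeGroup α),
      ∃ φ : ℕ → ℕ, StrictMono φ ∧ ∃ v : ℕ → FreeGroup α,
        Xor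
          (∃ Ψ : MulAut (FreeGroup α), ∀ n, MulAut.conj (v n) * Φ (φ n) = Ψ)
          (Tendsto (fun n => etaLength η (Φ (φ n))) atTop (𝓝 ∞))) := by
  have part1 : ∀ Φ : ℕ → MulAut (FreeGroup α),
      (∃ M : ℝ≥0, ∀ n, etaLength η (Φ n) ≤ M) →
      ∃ φ : ℕ → ℕ, StrictMono φ ∧ ∃ v : ℕ → FreeGroup α, ∃ Ψ : MulAut (FreeGroup α),
        ∀ n, MulAut.conj (v n) * Φ (φ n) = Ψ := by
    rintro Φ ⟨M, hM⟩
    obtain ⟨R, hR⟩ := exists_norm_conj_le hη hη0 hημ hc hb hquasi hprod M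
    choose v hv using fun n => hR (Φ n) (hM n)
    -- Pigeonhole: the normalized automorphisms lie in a finite set, so one of them occurs
    -- infinitely often.
    obtain ⟨Ψ, hΨ⟩ : ∃ Ψ, ∃ᶠ n in atTop, MulAut.conj (v n) * Φ n = Ψ := by
      by_contra! hno
      obtain ⟨n, hn⟩ := ((eventually_all_finite (FreeGroup.finite_mulAut_norm_le R)).mpr
        fun Ψ _ => hno Ψ).exists
      exact hn _ (hv n) rfl
    obtain ⟨φ, hφ, h⟩ := extraction_of_frequently_atTop hΨ
    exact ⟨φ, hφ, fun n => v (φ n), Ψ, h⟩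
  have hnot : ∀ (Φ : ℕ → MulAut (FreeGroup α)) (v : ℕ → FreeGroup α),
      (∃ Ψ, ∀ n, MulAut.conj (v n) * Φ n = Ψ) →
      ¬ Tendsto (fun n => etaLength η (Φ n)) atTop (𝓝 ∞) := by
    rintro Φ v ⟨Ψ, hΨ⟩ ht
    have h1 : (fun n => etaLength η (Φ n)) = fun _ => etaLength η Ψ := by
      funext n
      rw [← hΨ n, hη.etaLength_conj_mul]
    rw [h1] at ht
    exact (hημ.etaLength_lt_top hμ.finite Ψ).ne (tendsto_nhds_unique tendsto_const_nhds ht)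
  refine ⟨part1, fun Φ => ?_⟩
  -- Either some bound holds infinitely often and part 1 applies to that subsequence, or every bound
  -- eventually fails and the whole sequence tends to infinity.
  by_cases h : ∃ M : ℝ≥0, ∃ᶠ n in atTop, etaLength η (Φ n) ≤ M
  · obtain ⟨M, hM⟩ := h
    obtain ⟨φ, hφ, hφM⟩ := extraction_of_frequently_atTop hM
    obtain ⟨ψ, hψ, v, hΨ⟩ := part1 (fun n => Φ (φ n)) ⟨M, hφM⟩
    exact ⟨fun n => φ (ψ n), hφ.comp hψ, v,
      Or.inl ⟨hΨ, hnot (fun n => Φ (φ (ψ n))) v hΨ⟩⟩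
  · have ht : Tendsto (fun n => etaLength η (Φ n)) atTop (𝓝 ∞) := by
      rw [ENNReal.tendsto_nhds_top_iff_nnreal]
      intro M
      have hM : ¬ ∃ᶠ n in atTop, etaLength η (Φ n) ≤ M := fun hM => h ⟨M, hM⟩
      filter_upwards [not_frequently.mp hM] with n hn
      exact not_le.mp hn
    exact ⟨id, strictMono_id, fun _ => 1, Or.inr ⟨ht, fun hΨ => hnot Φ _ hΨ ht⟩⟩
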